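/- Let $0<r<1$ and let $\mu(r,1)$ be the measure on $\mathbb{R}$ with density $(1+x)\,k(x\!:\!r)$ with respect to Lebesgue measure, where $$k(x\!:\!r)=\frac{\sqrt{1-r^2}}{\pi(1-x^2)\sqrt{r^2-x^2}}\quad\text{for } x\in(-r,r),\qquad k(x\!:\!r)=0 \quad\text{otherwise.}$$ Then $\mu(r,1)$ is a probability measure, and its Jacobi parameters $(\beta_n)_{n\ge 0}$, $(\gamma_n)_{n\ge 0}$ exist, are unique, and are given by $$\beta_0=1-\sqrt{1-r^2},\qquad \beta_1=-\frac{1-\sqrt{1-r^2}}{2},\qquad \beta_n=0\ \ (n\ge 2),$$ $$\gamma_0=\sqrt{1-r^2}\,\bigl(1-\sqrt{1-r^2}\bigr),\qquad \gamma_n=\frac{r^2}{4}\ \ (n\ge 1).$$ Here the Jacobi parameters of a measure $\mu$ on $\mathbb{R}$ with finite moments and infinite support are the real numbers $\beta_n,\gamma_n$ for which the monic polynomials defined by $P_0(x)=1$, $P_1(x)=x-\beta_0$ and $xP_n(x)=P_{n+1}(x)+\beta_nP_n(x)+\gamma_{n-1}P_{n-1}(x)$ $(n\ge 1)$ are orthogonal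 in $L^2(\mu)$, each with nonzero norm. Moreover, with these parameters, for every $z\in\mathbb{C}\setminus[-r,r]$ the convergents of the following continued fraction converge to the Stieltjes transform of $\mu(r,1)$ at $z$: $$\int_{\mathbb{R}}\frac{d\mu(r,1)(x)}{z-x}=\cfrac{1}{z-\beta_0-\cfrac{\gamma_0}{z-\beta_1-\cfrac{\gamma_1}{z-\beta_2-\cfrac{\gamma_2}{\ddots}}}}.$$ -/

import Mathlib

open MeasureTheory Filter
open scoped Topology Polynomial

noncomputable section

/-- The limit density `k(x : r) = √(1 - r²) / (π (1 - x²) √(r² - x²)) · 1_{(-r, r)}(x)`. -/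
def konnoDensity (r x : ℝ) : ℝ :=
  (Set.Ioo (-r) r).indicator
    (fun y => √(1 - r ^ 2) / (Real.pi * (1 - y ^ 2) * √(r ^ 2 - y ^ 2))) x

/-- The measure `μ(r, c)` on `ℝ` with Lebesgue density `(1 + c x) k(x : r)`. -/
def konnoMeasure (r c : ℝ) : Measure ℝ :=
  volume.withDensity fun x => ENNReal.ofReal ((1 + c * x) * konnoDensity r x)

/-- The monic polynomials generated by real sequences `β`, `γ`:
`P₀ = 1`, `P₁ = X - β₀`, and `X Pₙ = Pₙ₊₁ + βₙ Pₙ + γₙ₋₁ Pₙ₋₁` for `n ≥ 1`. -/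
def jacobiPoly (β γ : ℕ → ℝ) : ℕ → ℝ[X]
  | 0 => 1
  | 1 => Polynomial.X - Polynomial.C (β 0)
  | n + 2 => (Polynomial.X - Polynomial.C (β (n + 1))) * jacobiPoly β γ (n + 1)
      - Polynomial.C (γ n) * jacobiPoly β γ n

/-- `β`, `γ` are the Jacobi parameters of the measure `μ` (with all moments finite and infinite
support): the coefficients of the three-term recurrence satisfied by the monic orthogonal
polynomials of `μ`. -/
structure IsJacobiParameters (μ : Measure ℝ) (β γ : ℕ → ℝ) : Prop where
  integrable_pow : ∀ n : ℕ, Integrable (fun x : ℝ => x ^ n) μ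
  orthogonal : ∀ m n : ℕ, m ≠ n →
    ∫ x, (jacobiPoly β γ m).eval x * (jacobiPoly β γ n).eval x ∂μ = 0
  norm_pos : ∀ n : ℕ, 0 < ∫ x, (jacobiPoly β γ n).eval x ^ 2 ∂μ

/-- The Stieltjes transform `G_μ(z) = ∫ dμ(x) / (z - x)`. -/
def stieltjesTransform (μ : Measure ℝ) (z : ℂ) : ℂ :=
  ∫ x : ℝ, 1 / (z - (x : ℂ)) ∂μ

/-- The formal infinite continued fraction
`1 / (z - β₀ - γ₀ / (z - β₁ - γ₁ / (z - β₂ - ⋯)))`. -/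
def jacobiFraction (β γ : ℕ → ℝ) (z : ℂ) : GenContFract ℂ where
  h := 0
  s := Stream'.Seq.ofStream fun n =>
    match n with
    | 0 => ⟨1, z - (β 0 : ℂ)⟩
    | n + 1 => ⟨-(γ n : ℂ), z - (β (n + 1) : ℂ)⟩

end

/-! Put `x = r cos θ`. The measure becomes `√(1 - r²) / (π (1 - r cos θ)) dθ` on `(0, π)`. With `t =
konnoRadius r`, for which `r (1 + t²) = 2 t`, this is the Poisson kernel `(1 - t²) / (π |1 - t
e^{iθ}|²)`, whose cosine moments are `t ^ n`. Hence `cos ((n+1)θ) - t cos (nθ)` is orthogonal to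
`cos (mθ)` for all `m ≤ n`. Normalised to be monic in `x`, these functions are the orthogonal
polynomials, and their recurrence coefficients are the stated parameters.

For the continued fraction, let `Pₙ` and `Qₙ` be the denominators and numerators of the convergents,
and `G` the Stieltjes transform. Then `Pₙ(z) G(z) - Qₙ(z) = ∫ Pₙ(x) / (z - x) dμ`, which is
`O((r/2)ⁿ)`. Writing `z = (r/2)(w + w⁻¹)` with `0 < |w| < 1`, `Pₙ(z)` is asymptotic to `(r/(2w))ⁿ (1
- t w)`, so the error of the convergent is `O(|w|ⁿ)`. -/

/-- A measure has at most one sequence of Jacobi parameters. -/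
theorem IsJacobiParameters.unique {μ : Measure ℝ} {β γ β' γ' : ℕ → ℝ}
    (h : IsJacobiParameters μ β γ) (h' : IsJacobiParameters μ β' γ') : β = β' ∧ γ = γ' := by
  have hint : ∀ p : ℝ[X], Integrable (fun x => p.eval x) μ := by
    intro p
    simp only [Polynomial.eval_eq_sum_range]
    exact integrable_finsetSum _ fun i _ => (h.integrable_pow i).const_mul _
  have hmul : ∀ p q : ℝ[X], Integrable (fun x => p.eval x * q.eval x) μ := by
    intro p q
    simpa using hint (p * q)
  have key : ∀ n, jacobiPoly β γ n = jacobiPoly β' γ' n ∧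
      jacobiPoly β γ (n + 1) = jacobiPoly β' γ' (n + 1) ∧ β n = β' n ∧
      ∀ m, m + 1 = n → γ m = γ' m := by
    intro n
    induction n with
    | zero =>
      have hb : β 0 = β' 0 := by
        have e1 := h.orthogonal 1 0 one_ne_zero
        have e2 := h'.orthogonal 1 0 one_ne_zero
        have e3 := h.norm_pos 0
        have i1 := hint Polynomial.X
        have i0 := hint 1
        simp only [jacobiPoly, Polynomial.eval_sub, Polynomial.eval_X, Polynomial.eval_C,
          Polynomial.eval_one, mul_one, one_pow] at e1 e2 e3 i1 i0
        have c : ∀ a : ℝ, ∫ x, (x - a) ∂μ = (∫ x, x ∂μ) - a * ∫ _, (1 : ℝ) ∂μ := by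
          intro a
          rw [← integral_const_mul, ← integral_sub i1 (i0.const_mul a)]
          simp
        rw [c] at e1 e2
        have : (β 0 - β' 0) * ∫ _, (1 : ℝ) ∂μ = 0 := by linarith
        rcases mul_eq_zero.1 this with h0 | h0
        · linarith
        · exact absurd h0 e3.ne'
      refine ⟨rfl, ?_, hb, by simp⟩
      simp [jacobiPoly, hb]
    | succ n ih =>
      obtain ⟨h0, h1, -, -⟩ := ih
      -- The `X` terms cancel because both recurrences share their two previous polynomials. Testing
      -- against `q = Pₙ₊₁` and `q = Pₙ` isolates one coefficient each.
      have expand : ∀ q : ℝ[X],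
          (∫ x, (jacobiPoly β γ (n + 2)).eval x * q.eval x ∂μ) -
            ∫ x, (jacobiPoly β' γ' (n + 2)).eval x * q.eval x ∂μ =
          (β' (n + 1) - β (n + 1)) * (∫ x, (jacobiPoly β γ (n + 1)).eval x * q.eval x ∂μ) +
            (γ' n - γ n) * ∫ x, (jacobiPoly β γ n).eval x * q.eval x ∂μ := by
        intro q
        rw [← integral_sub (hmul _ _) (hmul _ _), ← integral_const_mul, ← integral_const_mul,
          ← integral_add ((hmul _ _).const_mul _) ((hmul _ _).const_mul _)]
        congr 1
        ext x
        simp only [jacobiPoly, ← h0, ← h1, Polynomial.eval_sub, Polynomial.eval_mul,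
          Polynomial.eval_X, Polynomial.eval_C]
        ring
      have hb : β (n + 1) = β' (n + 1) := by
        have e := expand (jacobiPoly β γ (n + 1))
        have n1 := h.norm_pos (n + 1)
        rw [h.orthogonal (n + 2) (n + 1) (by omega), h.orthogonal n (n + 1) (by omega)] at e
        rw [h1, h'.orthogonal (n + 2) (n + 1) (by omega), ← h1] at e
        simp only [← pow_two, sub_zero, mul_zero, add_zero] at e
        rcases mul_eq_zero.1 e.symm with h0 | h0
        · linarith
        · exact absurd h0 n1.ne'
      have hg : γ n = γ' n := by
        have e := expand (jacobiPoly β γ n)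
        have n1 := h.norm_pos n
        rw [h.orthogonal (n + 2) n (by omega), h.orthogonal (n + 1) n (by omega)] at e
        rw [h0, h'.orthogonal (n + 2) n (by omega), ← h0] at e
        simp only [← pow_two, sub_zero, mul_zero, zero_add] at e
        rcases mul_eq_zero.1 e.symm with h0 | h0
        · linarith
        · exact absurd h0 n1.ne'
      refine ⟨h1, ?_, hb, fun m hm => ?_⟩
      · rw [jacobiPoly, jacobiPoly, hb, hg, h0, h1]
      · obtain rfl : m = n := by omega
        exact hg
  exact ⟨funext fun n => (key n).2.2.1, funext fun n => (key (n + 1)).2.2.2 n rfl⟩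

/-! ### Convergents and orthogonal polynomials -/

theorem jacobiFraction_dens (β γ : ℕ → ℝ) (z : ℂ) (n : ℕ) :
    (jacobiFraction β γ z).dens n = Polynomial.aeval z (jacobiPoly β γ n) := by
  induction n using Nat.twoStepInduction with
  | zero => simp [jacobiPoly]
  | one =>
    rw [GenContFract.first_den_eq (gp := ⟨1, z - (β 0 : ℂ)⟩) rfl]
    simp [jacobiPoly]
  | more n h0 h1 =>
    rw [GenContFract.dens_recurrence (gp := ⟨-(γ n : ℂ), z - (β (n + 1) : ℂ)⟩) rfl h0 h1]
    simp [jacobiPoly]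
    ring

/-- The Stieltjes transform times the denominator of a convergent, minus its numerator. -/
theorem aeval_mul_stieltjesTransform_sub_nums {μ : Measure ℝ} [IsProbabilityMeasure μ]
    {β γ : ℕ → ℝ} (h : IsJacobiParameters μ β γ) {z : ℂ} (hz : ∀ᵐ x : ℝ ∂μ, z ≠ x)
    (hint : ∀ p : ℝ[X], Integrable (fun x : ℝ => ((p.eval x : ℝ) : ℂ) / (z - x)) μ) (n : ℕ) :
    Polynomial.aeval z (jacobiPoly β γ n) * stieltjesTransform μ z
      - (jacobiFraction β γ z).nums n =
      ∫ x : ℝ, (((jacobiPoly β γ n).eval x : ℝ) : ℂ) / (z - x) ∂μ := by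
  have hint' : ∀ p : ℝ[X], Integrable (fun x => ((p.eval x : ℝ) : ℂ)) μ := by
    intro p
    refine Integrable.ofReal (𝕜 := ℂ) (f := fun x => p.eval x) ?_
    simp only [Polynomial.eval_eq_sum_range]
    exact integrable_finsetSum _ fun i _ => (h.integrable_pow i).const_mul _
  -- This is `(x - b) / (z - x) = (z - b) / (z - x) - 1`, integrated against `p`.
  have step : ∀ (p : ℝ[X]) (b : ℝ),
      ∫ x : ℝ, ((((Polynomial.X - Polynomial.C b) * p).eval x : ℝ) : ℂ) / (z - x) ∂μ =
        (z - b) * (∫ x : ℝ, ((p.eval x : ℝ) : ℂ) / (z - x) ∂μ) - ((∫ x, p.eval x ∂μ : ℝ) : ℂ) := by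
    intro p b
    rw [← integral_complex_ofReal, ← integral_const_mul, ← integral_sub ((hint p).const_mul _) (hint' p)]
    refine integral_congr_ae ?_
    filter_upwards [hz] with x hx
    have : z - x ≠ 0 := sub_ne_zero.2 hx
    simp only [Polynomial.eval_mul, Polynomial.eval_sub, Polynomial.eval_X, Polynomial.eval_C]
    push_cast
    field_simp
    ring
  induction n using Nat.twoStepInduction with
  | zero => simp [jacobiPoly, stieltjesTransform, jacobiFraction]
  | one =>
    rw [GenContFract.first_num_eq (gp := ⟨1, z - (β 0 : ℂ)⟩) rfl]
    have := step 1 (β 0)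
    simp only [mul_one] at this
    simp only [jacobiPoly]
    rw [this]
    simp [stieltjesTransform, jacobiFraction]
  | more n h0 h1 =>
    -- Orthogonality to `P₀ = 1` removes the inhomogeneous term of `step`, so the remainders obey
    -- the recurrence of the numerators and denominators.
    have orth : ∫ x, (jacobiPoly β γ (n + 1)).eval x ∂μ = 0 := by
      simpa [jacobiPoly] using h.orthogonal (n + 1) 0 (by omega)
    rw [GenContFract.nums_recurrence (gp := ⟨-(γ n : ℂ), z - (β (n + 1) : ℂ)⟩) rfl rfl rfl]
    have e : ∫ x : ℝ, (((jacobiPoly β γ (n + 2)).eval x : ℝ) : ℂ) / (z - x) ∂μ =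
        (z - β (n + 1)) * (∫ x : ℝ, (((jacobiPoly β γ (n + 1)).eval x : ℝ) : ℂ) / (z - x) ∂μ) -
          γ n * ∫ x : ℝ, (((jacobiPoly β γ n).eval x : ℝ) : ℂ) / (z - x) ∂μ := by
      have := step (jacobiPoly β γ (n + 1)) (β (n + 1))
      rw [orth, Complex.ofReal_zero, sub_zero] at this
      rw [← this, ← integral_const_mul, ← integral_sub (hint _) ((hint _).const_mul _)]
      congr 1
      ext x
      simp only [jacobiPoly, Polynomial.eval_sub, Polynomial.eval_mul, Polynomial.eval_X,
        Polynomial.eval_C]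
      push_cast
      ring
    rw [e, ← h0, ← h1]
    simp [jacobiPoly]
    ring

/-! ### The substitution `x = r cos θ` -/

theorem image_mul_cos_Ioo {r : ℝ} (hr : 0 < r) :
    (fun θ => r * Real.cos θ) '' Set.Ioo 0 Real.pi = Set.Ioo (-r) r := by
  ext x
  constructor
  · rintro ⟨θ, ⟨h0, h1⟩, rfl⟩
    have hs : 0 < Real.sin θ := Real.sin_pos_of_pos_of_lt_pi h0 h1
    have h : |Real.cos θ| < 1 := by
      rw [← sq_lt_one_iff_abs_lt_one]
      nlinarith [Real.sin_sq_add_cos_sq θ]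
    obtain ⟨ha, hb⟩ := abs_lt.1 h
    constructor <;> nlinarith
  · rintro ⟨h0, h1⟩
    have ha : -1 < x / r := by rw [lt_div_iff₀ hr]; linarith
    have hb : x / r < 1 := by rw [div_lt_iff₀ hr]; linarith
    refine ⟨Real.arccos (x / r), ⟨Real.arccos_pos.2 hb, ?_⟩, ?_⟩
    · refine lt_of_le_of_ne (Real.arccos_le_pi _) fun h => ?_
      rw [Real.arccos_eq_pi] at h
      linarith
    · simp only [Real.cos_arccos ha.le hb.le]
      field_simp

theorem injOn_mul_cos {r : ℝ} (hr : 0 < r) :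
    Set.InjOn (fun θ => r * Real.cos θ) (Set.Ioo 0 Real.pi) := by
  intro a ha b hb h
  exact Real.injOn_cos (Set.Ioo_subset_Icc_self ha) (Set.Ioo_subset_Icc_self hb)
    (mul_left_cancel₀ hr.ne' h)

/-- The density of `konnoMeasure r 1` in the variable `θ`, where `x = r * cos θ`. -/
noncomputable def konnoAngularDensity (r θ : ℝ) : ℝ :=
  √(1 - r ^ 2) / (Real.pi * (1 - r * Real.cos θ))

theorem one_sub_mul_cos_pos {r : ℝ} (hr0 : 0 < r) (hr1 : r < 1) (θ : ℝ) :
    0 < 1 - r * Real.cos θ := by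
  nlinarith [Real.cos_le_one θ]

theorem konnoAngularDensity_nonneg {r : ℝ} (hr0 : 0 < r) (hr1 : r < 1) (θ : ℝ) :
    0 ≤ konnoAngularDensity r θ := by
  have := one_sub_mul_cos_pos hr0 hr1 θ
  unfold konnoAngularDensity
  positivity

theorem continuous_konnoAngularDensity {r : ℝ} (hr0 : 0 < r) (hr1 : r < 1) :
    Continuous (konnoAngularDensity r) := by
  unfold konnoAngularDensity
  refine Continuous.div (by fun_prop) (by fun_prop) fun θ => ?_
  have := one_sub_mul_cos_pos hr0 hr1 θ
  positivity

theorem konnoDensity_mul_cos {r : ℝ} (hr0 : 0 < r) (hr1 : r < 1) {θ : ℝ}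
    (hθ : θ ∈ Set.Ioo 0 Real.pi) :
    |-(r * Real.sin θ)| * ((1 + 1 * (r * Real.cos θ)) * konnoDensity r (r * Real.cos θ)) =
      konnoAngularDensity r θ := by
  have hs : 0 < Real.sin θ := Real.sin_pos_of_pos_of_lt_pi hθ.1 hθ.2
  have hmem : r * Real.cos θ ∈ Set.Ioo (-r) r := by
    rw [← image_mul_cos_Ioo hr0]
    exact ⟨θ, hθ, rfl⟩
  have h1 := one_sub_mul_cos_pos hr0 hr1 θ
  have h2 : 0 < 1 + r * Real.cos θ := by linarith [hmem.1]
  have hroot : √(r ^ 2 - (r * Real.cos θ) ^ 2) = r * Real.sin θ := by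
    rw [← Real.sqrt_sq (by positivity : 0 ≤ r * Real.sin θ)]
    congr 1
    nlinarith [Real.sin_sq_add_cos_sq θ]
  have h3 : 1 - (r * Real.cos θ) ^ 2 = (1 - r * Real.cos θ) * (1 + r * Real.cos θ) := by ring
  rw [konnoDensity, Set.indicator_of_mem hmem, hroot, abs_neg, abs_of_pos (by positivity), h3,
    konnoAngularDensity]
  field_simp

theorem konnoMeasure_density_nonneg {r : ℝ} (hr1 : r < 1) (x : ℝ) :
    0 ≤ (1 + 1 * x) * konnoDensity r x := by
  unfold konnoDensity
  by_cases hx : x ∈ Set.Ioo (-r) r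
  · rw [Set.indicator_of_mem hx]
    obtain ⟨h0, h1⟩ := hx
    have h2 : 0 < 1 - x ^ 2 := by nlinarith
    have h3 : 0 < 1 + 1 * x := by linarith
    have := Real.pi_pos
    positivity
  · simp [Set.indicator_of_notMem hx]

theorem konnoMeasure_density_eq_zero {r x : ℝ} (hx : x ∉ Set.Ioo (-r) r) :
    (1 + 1 * x) * konnoDensity r x = 0 := by
  simp [konnoDensity, Set.indicator_of_notMem hx]

theorem measurable_konnoMeasure_density (r : ℝ) :
    Measurable fun x => (1 + 1 * x) * konnoDensity r x := by
  unfold konnoDensity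
  exact (by fun_prop : Measurable fun x : ℝ => 1 + 1 * x).mul
    (Measurable.indicator (by fun_prop) measurableSet_Ioo)

theorem hasDerivWithinAt_mul_cos (r θ : ℝ) (s : Set ℝ) :
    HasDerivWithinAt (fun θ => r * Real.cos θ) (-(r * Real.sin θ)) s θ := by
  simpa using ((Real.hasDerivAt_cos θ).const_mul r).hasDerivWithinAt

/-- Integration against `konnoMeasure r 1` in the variable `θ`, where `x = r * cos θ`. -/
theorem integral_konnoMeasure {r : ℝ} (hr0 : 0 < r) (hr1 : r < 1) (f : ℝ → ℝ) :
    ∫ x, f x ∂(konnoMeasure r 1) =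
      ∫ θ in 0..Real.pi, konnoAngularDensity r θ * f (r * Real.cos θ) := by
  have hsupp : ∀ x ∉ Set.Ioo (-r) r, (1 + 1 * x) * konnoDensity r x * f x = 0 := fun x hx => by
    rw [konnoMeasure_density_eq_zero hx, zero_mul]
  rw [konnoMeasure, integral_withDensity_eq_integral_toReal_smul
    (measurable_konnoMeasure_density r).ennreal_ofReal (by simp)]
  simp_rw [ENNReal.toReal_ofReal (konnoMeasure_density_nonneg hr1 _), smul_eq_mul]
  rw [← setIntegral_eq_integral_of_forall_compl_eq_zero hsupp, ← image_mul_cos_Ioo hr0,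
    integral_image_eq_integral_abs_deriv_smul measurableSet_Ioo
      (fun θ _ => hasDerivWithinAt_mul_cos r θ _) (injOn_mul_cos hr0),
    intervalIntegral.integral_of_le Real.pi_pos.le, integral_Ioc_eq_integral_Ioo]
  refine setIntegral_congr_fun measurableSet_Ioo fun θ hθ => ?_
  simp only [smul_eq_mul]
  rw [← konnoDensity_mul_cos hr0 hr1 hθ]
  ring

/-! ### The Poisson kernel and its cosine moments -/

/-- `(1 - √(1 - r²)) / r`, so that `1 - r cos θ` is proportional to `|1 - t e^{iθ}|²`. -/
noncomputable def konnoRadius (r : ℝ) : ℝ := (1 - √(1 - r ^ 2)) / r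

section

variable {r : ℝ}

theorem sqrt_one_sub_sq_mem_Ioo (hr0 : 0 < r) (hr1 : r < 1) : √(1 - r ^ 2) ∈ Set.Ioo 0 1 := by
  have h : 0 < 1 - r ^ 2 := by nlinarith
  refine ⟨Real.sqrt_pos.2 h, ?_⟩
  rw [Real.sqrt_lt' one_pos]
  nlinarith

theorem konnoRadius_mul (hr0 : 0 < r) : konnoRadius r * r = 1 - √(1 - r ^ 2) := by
  unfold konnoRadius
  field_simp

/-- This relation yields `|1 - t e^{iθ}|² = (1 + t²)(1 - r cos θ)`. -/
theorem konnoRadius_quadratic (hr0 : 0 < r) (hr1 : r < 1) :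
    r * (1 + konnoRadius r ^ 2) = 2 * konnoRadius r := by
  have h : √(1 - r ^ 2) ^ 2 = 1 - r ^ 2 := Real.sq_sqrt (by nlinarith)
  have h1 := konnoRadius_mul hr0
  have : r * (r * (1 + konnoRadius r ^ 2)) = r * (2 * konnoRadius r) := by
    linear_combination (konnoRadius r * r + (1 - √(1 - r ^ 2)) - 2) * h1 + h
  exact mul_left_cancel₀ hr0.ne' this

theorem konnoRadius_mem_Ioo (hr0 : 0 < r) (hr1 : r < 1) : konnoRadius r ∈ Set.Ioo 0 1 := by
  obtain ⟨h0, h1⟩ := sqrt_one_sub_sq_mem_Ioo hr0 hr1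
  have hp : 0 < konnoRadius r := div_pos (by linarith) hr0
  refine ⟨hp, ?_⟩
  have h2 := konnoRadius_quadratic hr0 hr1
  have h3 := konnoRadius_mul hr0
  by_contra! h
  have h4 : √(1 - r ^ 2) ^ 2 = 1 - r ^ 2 := Real.sq_sqrt (by nlinarith)
  have h5 : r ≤ 1 - √(1 - r ^ 2) := by nlinarith
  nlinarith

theorem sqrt_mul_one_add_konnoRadius_sq (hr0 : 0 < r) (hr1 : r < 1) :
    √(1 - r ^ 2) * (1 + konnoRadius r ^ 2) = 1 - konnoRadius r ^ 2 := by
  linear_combination (konnoRadius r ^ 2 + 1) * konnoRadius_mul hr0 -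
    konnoRadius r * konnoRadius_quadratic hr0 hr1

theorem integral_konnoAngularDensity (hr0 : 0 < r) (hr1 : r < 1) :
    ∫ θ in 0..Real.pi, konnoAngularDensity r θ = 1 := by
  set t := konnoRadius r with ht
  obtain ⟨ht0, ht1⟩ := konnoRadius_mem_Ioo hr0 hr1
  have hq := konnoRadius_quadratic hr0 hr1
  have hs := sqrt_mul_one_add_konnoRadius_sq hr0 hr1
  rw [← ht] at ht0 ht1 hq hs
  have hpos : ∀ θ, 0 < 1 - t * Real.cos θ := one_sub_mul_cos_pos ht0 ht1
  -- Integrating `1 + 2 ∑ tⁿ cos nθ` termwise gives `θ - 2 arg (1 - t e^{iθ})`. The `arctan` term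
  -- vanishes at both endpoints.
  have hderiv : ∀ θ ∈ Set.uIcc 0 Real.pi, HasDerivAt (fun θ => (θ + 2 * Real.arctan
      (t * Real.sin θ / (1 - t * Real.cos θ))) / Real.pi) (konnoAngularDensity r θ) θ := by
    intro θ _
    have h1 := ((Real.hasDerivAt_sin θ).const_mul t).div
      (((Real.hasDerivAt_cos θ).const_mul t).const_sub 1) (hpos θ).ne'
    refine (((hasDerivAt_id θ).add (h1.arctan.const_mul 2)).div_const Real.pi).congr_deriv ?_
    have hp := hpos θ
    have hr := one_sub_mul_cos_pos hr0 hr1 θ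
    have hpi := Real.pi_pos
    have hsc := Real.sin_sq_add_cos_sq θ
    have hd : (1 - t * Real.cos θ) ^ 2 + (t * Real.sin θ) ^ 2 =
        (1 + t ^ 2) * (1 - r * Real.cos θ) := by
      linear_combination t ^ 2 * hsc + Real.cos θ * hq
    have e : 1 / (1 + (t * Real.sin θ / (1 - t * Real.cos θ)) ^ 2) =
        (1 - t * Real.cos θ) ^ 2 / ((1 + t ^ 2) * (1 - r * Real.cos θ)) := by
      rw [← hd]
      have : (1 - t * Real.cos θ) ^ 2 + (t * Real.sin θ) ^ 2 ≠ 0 := by positivity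
      field_simp
    simp only [Pi.div_apply]
    rw [e, konnoAngularDensity]
    have : √(1 - r ^ 2) = (1 - t ^ 2) / (1 + t ^ 2) := by
      rw [← hs]; field_simp
    have hr2 : 1 - Real.cos θ * r ≠ 0 := by rw [mul_comm]; exact hr.ne'
    rw [this]
    field_simp
    linear_combination (-2 * t ^ 2) * hsc - Real.cos θ * hq
  rw [intervalIntegral.integral_eq_sub_of_hasDerivAt hderiv
    ((continuous_konnoAngularDensity hr0 hr1).intervalIntegrable _ _)]
  simp

theorem isProbabilityMeasure_konnoMeasure (hr0 : 0 < r) (hr1 : r < 1) :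
    IsProbabilityMeasure (konnoMeasure r 1) := by
  constructor
  have hsupp : Function.support (fun x => ENNReal.ofReal ((1 + 1 * x) * konnoDensity r x)) ⊆
      Set.Ioo (-r) r := by
    intro x hx
    by_contra h
    rw [Function.mem_support, konnoMeasure_density_eq_zero h, ENNReal.ofReal_zero] at hx
    exact hx rfl
  rw [konnoMeasure, withDensity_apply _ MeasurableSet.univ, Measure.restrict_univ,
    ← setLIntegral_eq_of_support_subset hsupp, ← image_mul_cos_Ioo hr0,
    lintegral_image_eq_lintegral_abs_deriv_mul measurableSet_Ioo
      (fun θ _ => hasDerivWithinAt_mul_cos r θ _) (injOn_mul_cos hr0)]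
  have : ∫⁻ θ in Set.Ioo 0 Real.pi, ENNReal.ofReal (konnoAngularDensity r θ) = 1 := by
    rw [← ofReal_integral_eq_lintegral_ofReal, ← integral_Ioc_eq_integral_Ioo,
      ← intervalIntegral.integral_of_le Real.pi_pos.le, integral_konnoAngularDensity hr0 hr1,
      ENNReal.ofReal_one]
    · exact (((continuous_konnoAngularDensity hr0 hr1).integrableOn_Icc).mono_set
        Set.Ioo_subset_Icc_self)
    · exact ae_of_all _ (konnoAngularDensity_nonneg hr0 hr1)
  rw [← this]
  refine setLIntegral_congr_fun measurableSet_Ioo fun θ hθ => ?_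
  rw [← ENNReal.ofReal_mul (abs_nonneg _), konnoDensity_mul_cos hr0 hr1 hθ]

theorem ae_mem_Icc_konnoMeasure (r : ℝ) : ∀ᵐ x ∂(konnoMeasure r 1), x ∈ Set.Icc (-r) r := by
  rw [konnoMeasure, ae_withDensity_iff (measurable_konnoMeasure_density r).ennreal_ofReal]
  refine ae_of_all _ fun x hx => ?_
  by_contra h
  rw [konnoMeasure_density_eq_zero fun h' => h (Set.Ioo_subset_Icc_self h')] at hx
  simp at hx

theorem integrable_konnoMeasure {E : Type*} [NormedAddCommGroup E] (hr0 : 0 < r) (hr1 : r < 1)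
    {f : ℝ → E} (hf : ContinuousOn f (Set.Icc (-r) r)) : Integrable f (konnoMeasure r 1) := by
  have := isProbabilityMeasure_konnoMeasure hr0 hr1
  rw [← Measure.restrict_eq_self_of_ae_mem (ae_mem_Icc_konnoMeasure r)]
  exact hf.integrableOn_compact isCompact_Icc

/-- Multiplying the density by `1 - r cos θ` leaves a constant, which is orthogonal to `cos
((n+1)θ)`. So the moments satisfy `r (cₙ₊₂ + cₙ) = 2 cₙ₊₁`, as do the powers of `t`. -/
theorem integral_konnoAngularDensity_mul_cos (hr0 : 0 < r) (hr1 : r < 1) (n : ℕ) :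
    ∫ θ in 0..Real.pi, konnoAngularDensity r θ * Real.cos (n * θ) = konnoRadius r ^ n := by
  have hc := continuous_konnoAngularDensity hr0 hr1
  have hii : ∀ n : ℕ, IntervalIntegrable
      (fun θ => konnoAngularDensity r θ * Real.cos (n * θ)) volume 0 Real.pi := fun n =>
    Continuous.intervalIntegrable (by fun_prop) _ _
  have hd : ∀ θ, konnoAngularDensity r θ * (r * Real.cos θ) =
      konnoAngularDensity r θ - √(1 - r ^ 2) / Real.pi := by
    intro θ
    have := one_sub_mul_cos_pos hr0 hr1 θ
    have := Real.pi_pos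
    unfold konnoAngularDensity
    field_simp
    ring
  have h0 := integral_konnoAngularDensity hr0 hr1
  induction n using Nat.twoStepInduction with
  | zero => simpa using h0
  | one =>
    have e : ∫ θ in 0..Real.pi, r * (konnoAngularDensity r θ * Real.cos ((1 : ℕ) * θ)) =
        ∫ θ in 0..Real.pi, (konnoAngularDensity r θ - √(1 - r ^ 2) / Real.pi) := by
      congr 1
      ext θ
      rw [← hd]
      push_cast
      rw [one_mul]
      ring
    rw [intervalIntegral.integral_const_mul, intervalIntegral.integral_sub
      (hc.intervalIntegrable _ _) (by simp), h0] at e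
    have hpi := Real.pi_pos.ne'
    have : Real.pi * (√(1 - r ^ 2) / Real.pi) = √(1 - r ^ 2) := by field_simp
    simp only [intervalIntegral.integral_const, sub_zero, smul_eq_mul, this] at e
    rw [pow_one, konnoRadius, ← e]
    field_simp
  | more n ih0 ih1 =>
    have hcos : ∫ θ in 0..Real.pi, Real.cos ((n + 1 : ℕ) * θ) = 0 := by
      rw [intervalIntegral.integral_comp_mul_left (fun x => Real.cos x) (by positivity),
        integral_cos, Real.sin_nat_mul_pi]
      simp
    have e : ∫ θ in 0..Real.pi, (r * (konnoAngularDensity r θ * Real.cos ((n + 2 : ℕ) * θ)) +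
          r * (konnoAngularDensity r θ * Real.cos (n * θ))) =
        ∫ θ in 0..Real.pi, (2 * (konnoAngularDensity r θ * Real.cos ((n + 1 : ℕ) * θ)) -
          2 * (√(1 - r ^ 2) / Real.pi) * Real.cos ((n + 1 : ℕ) * θ)) := by
      congr 1
      ext θ
      have e1 : ((n + 2 : ℕ) : ℝ) * θ = (n + 1 : ℕ) * θ + θ := by push_cast; ring
      have e2 : (n : ℝ) * θ = (n + 1 : ℕ) * θ - θ := by push_cast; ring
      rw [e1, e2, Real.cos_add, Real.cos_sub]
      linear_combination 2 * Real.cos ((n + 1 : ℕ) * θ) * hd θ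
    rw [intervalIntegral.integral_add ((hii _).const_mul _) ((hii _).const_mul _),
      intervalIntegral.integral_sub ((hii _).const_mul _)
        (Continuous.intervalIntegrable (by fun_prop) _ _)] at e
    simp only [intervalIntegral.integral_const_mul, hcos, ih0, ih1] at e
    refine mul_left_cancel₀ hr0.ne' ?_
    linear_combination e - konnoRadius r ^ n * konnoRadius_quadratic hr0 hr1

theorem integral_konnoAngularDensity_mul_cos_mul_cos (hr0 : 0 < r) (hr1 : r < 1) (m d : ℕ) :
    ∫ θ in 0..Real.pi,
      konnoAngularDensity r θ * (Real.cos (m * θ) * Real.cos ((m + d : ℕ) * θ)) =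
      (konnoRadius r ^ (2 * m + d) + konnoRadius r ^ d) / 2 := by
  have hc := continuous_konnoAngularDensity hr0 hr1
  have hii : ∀ n : ℕ, IntervalIntegrable
      (fun θ => konnoAngularDensity r θ * Real.cos (n * θ)) volume 0 Real.pi := fun n =>
    Continuous.intervalIntegrable (by fun_prop) _ _
  rw [← integral_konnoAngularDensity_mul_cos hr0 hr1, ← integral_konnoAngularDensity_mul_cos hr0 hr1,
    ← intervalIntegral.integral_add (hii _) (hii _), ← intervalIntegral.integral_div]
  congr 1
  ext θ
  have e1 : ((2 * m + d : ℕ) : ℝ) * θ = (m + d : ℕ) * θ + m * θ := by push_cast; ring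
  have e2 : (d : ℝ) * θ = (m + d : ℕ) * θ - m * θ := by push_cast; ring
  rw [e1, e2, Real.cos_add, Real.cos_sub]
  ring

end

/-! ### The orthogonal polynomials -/

/-- The diagonal Jacobi parameters of `konnoMeasure r 1`. -/
noncomputable def konnoBeta (r : ℝ) : ℕ → ℝ
  | 0 => 1 - √(1 - r ^ 2)
  | 1 => -(1 - √(1 - r ^ 2)) / 2
  | _ + 2 => 0

/-- The off-diagonal Jacobi parameters of `konnoMeasure r 1`. -/
noncomputable def konnoGamma (r : ℝ) : ℕ → ℝ
  | 0 => √(1 - r ^ 2) * (1 - √(1 - r ^ 2))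
  | _ + 1 => r ^ 2 / 4

section

variable {r : ℝ}

/-- From `P₃` on, the recurrence is the addition formula for cosines. The exceptional values `β₀`,
`β₁`, `γ₀` fit the initial terms. The formula fails for `P₀`, hence the shifted index. -/
theorem eval_jacobiPoly_konno (hr0 : 0 < r) (hr1 : r < 1) (n : ℕ) (θ : ℝ) :
    (jacobiPoly (konnoBeta r) (konnoGamma r) (n + 1)).eval (r * Real.cos θ) =
      2 * (r / 2) ^ (n + 1) *
        (Real.cos ((n + 1 : ℕ) * θ) - konnoRadius r * Real.cos (n * θ)) := by
  have hs : √(1 - r ^ 2) = 1 - konnoRadius r * r := by rw [konnoRadius_mul hr0]; ring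
  have hq := konnoRadius_quadratic hr0 hr1
  induction n using Nat.twoStepInduction with
  | zero =>
    simp [jacobiPoly, konnoBeta, hs]
    ring
  | one =>
    have e : Real.cos ((1 + 1 : ℕ) * θ) = 2 * Real.cos θ ^ 2 - 1 := by
      rw [← Real.cos_two_mul]; norm_num
    rw [e]
    simp [jacobiPoly, konnoBeta, konnoGamma, hs]
    linear_combination r / 2 * hq
  | more n h0 h1 =>
    rw [jacobiPoly, Polynomial.eval_sub, Polynomial.eval_mul, Polynomial.eval_mul, h0, h1]
    simp only [konnoBeta, konnoGamma, Polynomial.eval_sub, Polynomial.eval_X, Polynomial.eval_C]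
    have e3 : ((n + 2 + 1 : ℕ) : ℝ) * θ = (n + 1 + 1 : ℕ) * θ + θ := by push_cast; ring
    have e2 : ((n + 2 : ℕ) : ℝ) * θ = (n + 1 + 1 : ℕ) * θ := by push_cast; ring
    have e1 : ((n + 1 : ℕ) : ℝ) * θ = (n + 1 + 1 : ℕ) * θ - θ := by push_cast; ring
    have e0 : Real.cos (n * θ) =
        2 * Real.cos θ * Real.cos ((n + 1 : ℕ) * θ) - Real.cos ((n + 1 + 1 : ℕ) * θ) := by
      have ea : ((n + 1 + 1 : ℕ) : ℝ) * θ = (n + 1 : ℕ) * θ + θ := by push_cast; ring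
      have eb : (n : ℝ) * θ = (n + 1 : ℕ) * θ - θ := by push_cast; ring
      rw [ea, eb, Real.cos_add, Real.cos_sub]
      ring
    rw [e0, e3, e2, e1, Real.cos_add, Real.cos_sub]
    ring

/-- The previous formula with `e^{iθ}` replaced by `w`, cleared of negative powers. For `|w| < 1`
the right side tends to `1 - t w`. -/
theorem aeval_jacobiPoly_konno (hr0 : 0 < r) (hr1 : r < 1) (n : ℕ) {w : ℂ} (hw : w ≠ 0) :
    (w * (2 / r)) ^ (n + 1) * Polynomial.aeval ((r / 2 : ℂ) * (w + w⁻¹))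
        (jacobiPoly (konnoBeta r) (konnoGamma r) (n + 1)) =
      1 - konnoRadius r * w + (w ^ (2 * n + 2) - konnoRadius r * w ^ (2 * n + 1)) := by
  have hs : √(1 - r ^ 2) = 1 - konnoRadius r * r := by rw [konnoRadius_mul hr0]; ring
  have hq : (r : ℂ) * (1 + (konnoRadius r : ℂ) ^ 2) = 2 * konnoRadius r := by
    exact_mod_cast konnoRadius_quadratic hr0 hr1
  have hr : (r : ℂ) ≠ 0 := by exact_mod_cast hr0.ne'
  induction n using Nat.twoStepInduction with
  | zero =>
    simp [jacobiPoly, konnoBeta, hs]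
    field_simp
    ring
  | one =>
    simp [jacobiPoly, konnoBeta, konnoGamma, hs]
    field_simp
    linear_combination 2 * w ^ 2 * hq
  | more n h0 h1 =>
    rw [jacobiPoly, map_sub, map_mul, map_mul]
    simp only [konnoBeta, konnoGamma, map_sub, Polynomial.aeval_X, Polynomial.aeval_C]
    set p := Polynomial.aeval ((r / 2 : ℂ) * (w + w⁻¹))
        (jacobiPoly (konnoBeta r) (konnoGamma r) (n + 1))
    set q := Polynomial.aeval ((r / 2 : ℂ) * (w + w⁻¹))
        (jacobiPoly (konnoBeta r) (konnoGamma r) (n + 1 + 1))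
    have e : (w * (2 / r)) ^ (n + 2 + 1) * (((r / 2 : ℂ) * (w + w⁻¹) - algebraMap ℝ ℂ 0) * q -
        algebraMap ℝ ℂ (r ^ 2 / 4) * p) = (w ^ 2 + 1) * ((w * (2 / r)) ^ (n + 1 + 1) * q) -
          w ^ 2 * ((w * (2 / r)) ^ (n + 1) * p) := by
      rw [show n + 2 + 1 = n + 1 + 1 + 1 from rfl, pow_succ, pow_succ _ (n + 1)]
      generalize (w * (2 / (r : ℂ))) ^ (n + 1) = u
      simp
      field_simp
      ring
    rw [e, h0, h1]
    ring

theorem isJacobiParameters_konno (hr0 : 0 < r) (hr1 : r < 1) :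
    IsJacobiParameters (konnoMeasure r 1) (konnoBeta r) (konnoGamma r) := by
  have hc := continuous_konnoAngularDensity hr0 hr1
  have ht := konnoRadius_mem_Ioo hr0 hr1
  have hii : ∀ m n : ℕ, IntervalIntegrable (fun θ => konnoAngularDensity r θ *
      (Real.cos (m * θ) * Real.cos (n * θ))) volume 0 Real.pi := fun m n =>
    Continuous.intervalIntegrable (by fun_prop) _ _
  -- Raising `d` by one multiplies the moment `(t^(2m+d) + t^d) / 2` by `t`.
  have orth : ∀ m d : ℕ, ∫ θ in 0..Real.pi, konnoAngularDensity r θ * (Real.cos (m * θ) *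
      (Real.cos ((m + d + 1 : ℕ) * θ) - konnoRadius r * Real.cos ((m + d : ℕ) * θ))) = 0 := by
    intro m d
    have h1 := integral_konnoAngularDensity_mul_cos_mul_cos hr0 hr1 m (d + 1)
    have h2 := integral_konnoAngularDensity_mul_cos_mul_cos hr0 hr1 m d
    calc _ = ∫ θ in 0..Real.pi, (konnoAngularDensity r θ *
          (Real.cos (m * θ) * Real.cos ((m + (d + 1) : ℕ) * θ)) - konnoRadius r *
          (konnoAngularDensity r θ * (Real.cos (m * θ) * Real.cos ((m + d : ℕ) * θ)))) := by
          congr 1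
          ext θ
          rw [← add_assoc]
          ring
      _ = 0 := by
          rw [intervalIntegral.integral_sub (hii _ _) ((hii _ _).const_mul _),
            intervalIntegral.integral_const_mul, h1, h2]
          ring
  have hlt : ∀ m d : ℕ, ∫ x, (jacobiPoly (konnoBeta r) (konnoGamma r) m).eval x *
      (jacobiPoly (konnoBeta r) (konnoGamma r) (m + d + 1)).eval x ∂(konnoMeasure r 1) = 0 := by
    intro m d
    rw [integral_konnoMeasure hr0 hr1]
    simp_rw [eval_jacobiPoly_konno hr0 hr1]
    cases m with
    | zero =>
      have h := orth 0 d
      calc _ = ∫ θ in 0..Real.pi, 2 * (r / 2) ^ (0 + d + 1) * (konnoAngularDensity r θ *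
            (Real.cos ((0 : ℕ) * θ) * (Real.cos ((0 + d + 1 : ℕ) * θ) -
              konnoRadius r * Real.cos ((0 + d : ℕ) * θ)))) := by
            congr 1
            ext θ
            simp [jacobiPoly]
            ring
        _ = 0 := by rw [intervalIntegral.integral_const_mul, h, mul_zero]
    | succ k =>
      -- The lower polynomial mixes `cos ((k+1)θ)` and `cos (kθ)`; each is orthogonal to the higher
      -- one.
      have h := orth (k + 1) d
      have h' := orth k (d + 1)
      rw [show k + (d + 1) = k + 1 + d by ring] at h'
      have hI : ∀ a : ℕ, IntervalIntegrable (fun θ => konnoAngularDensity r θ *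
          (Real.cos (a * θ) * (Real.cos ((k + 1 + d + 1 : ℕ) * θ) -
            konnoRadius r * Real.cos ((k + 1 + d : ℕ) * θ)))) volume 0 Real.pi := fun a =>
        Continuous.intervalIntegrable (by fun_prop) _ _
      calc _ = ∫ θ in 0..Real.pi, 4 * (r / 2) ^ (k + 1) * (r / 2) ^ (k + 1 + d + 1) *
            (konnoAngularDensity r θ *
            (Real.cos ((k + 1 : ℕ) * θ) * (Real.cos ((k + 1 + d + 1 : ℕ) * θ) -
              konnoRadius r * Real.cos ((k + 1 + d : ℕ) * θ))) - konnoRadius r *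
            (konnoAngularDensity r θ *
            (Real.cos (k * θ) * (Real.cos ((k + 1 + d + 1 : ℕ) * θ) -
              konnoRadius r * Real.cos ((k + 1 + d : ℕ) * θ))))) := by
            congr 1
            ext θ
            rw [eval_jacobiPoly_konno hr0 hr1]
            ring
        _ = 0 := by
            rw [intervalIntegral.integral_const_mul, intervalIntegral.integral_sub (hI _)
              ((hI _).const_mul _), intervalIntegral.integral_const_mul, h, h']
            ring
  refine ⟨fun n => integrable_konnoMeasure hr0 hr1 (by fun_prop), fun m n hmn => ?_, fun n => ?_⟩
  · rcases hmn.lt_or_gt with h | h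
    · obtain ⟨d, rfl⟩ := Nat.exists_eq_add_of_lt h
      exact hlt m d
    · obtain ⟨d, rfl⟩ := Nat.exists_eq_add_of_lt h
      simp_rw [mul_comm (Polynomial.eval _ (jacobiPoly _ _ (n + d + 1)))]
      exact hlt n d
  · rw [integral_konnoMeasure hr0 hr1]
    cases n with
    | zero => simp [jacobiPoly, integral_konnoAngularDensity hr0 hr1]
    | succ n =>
      simp_rw [eval_jacobiPoly_konno hr0 hr1]
      -- Orthogonality to `cos (nθ)` leaves only the pairing with `cos ((n+1)θ)`, equal to `(1 - t²)
      -- / 2`.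
      have h := orth n 0
      have h1 := integral_konnoAngularDensity_mul_cos_mul_cos hr0 hr1 (n + 1) 0
      have h2 := integral_konnoAngularDensity_mul_cos_mul_cos hr0 hr1 n 1
      have hI : IntervalIntegrable (fun θ => konnoAngularDensity r θ *
          (Real.cos (n * θ) * (Real.cos ((n + 0 + 1 : ℕ) * θ) -
            konnoRadius r * Real.cos ((n + 0 : ℕ) * θ)))) volume 0 Real.pi :=
        Continuous.intervalIntegrable (by fun_prop) _ _
      have e : ∫ θ in 0..Real.pi, konnoAngularDensity r θ * (2 * (r / 2) ^ (n + 1) *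
          (Real.cos ((n + 1 : ℕ) * θ) - konnoRadius r * Real.cos (n * θ))) ^ 2 =
          4 * (r / 2) ^ (2 * (n + 1)) * ((1 - konnoRadius r ^ 2) / 2) := by
        calc _ = ∫ θ in 0..Real.pi, 4 * (r / 2) ^ (2 * (n + 1)) *
            (konnoAngularDensity r θ *
              (Real.cos ((n + 1 : ℕ) * θ) * Real.cos ((n + 1 + 0 : ℕ) * θ)) -
            konnoRadius r * (konnoAngularDensity r θ *
              (Real.cos (n * θ) * Real.cos ((n + 1 : ℕ) * θ))) -
            konnoRadius r * (konnoAngularDensity r θ *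
              (Real.cos (n * θ) * (Real.cos ((n + 0 + 1 : ℕ) * θ) -
              konnoRadius r * Real.cos ((n + 0 : ℕ) * θ))))) := by
              congr 1
              ext θ
              simp only [add_zero]
              ring
          _ = _ := by
            rw [intervalIntegral.integral_const_mul, intervalIntegral.integral_sub
              ((hii _ _).sub ((hii _ _).const_mul _)) (hI.const_mul _),
              intervalIntegral.integral_sub (hii _ _) ((hii _ _).const_mul _),
              intervalIntegral.integral_const_mul, intervalIntegral.integral_const_mul, h, h1, h2]
            ring
      rw [e]
      have : 0 < 1 - konnoRadius r ^ 2 := by nlinarith [ht.1, ht.2]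
      positivity

/-! ### Convergence of the continued fraction -/

/-- The inverse of the Joukowski map, with values in the punctured open unit disc. -/
theorem exists_joukowski (hr0 : 0 < r) {z : ℂ}
    (hz : z ∉ (fun x : ℝ => (x : ℂ)) '' Set.Icc (-r) r) :
    ∃ w : ℂ, w ≠ 0 ∧ ‖w‖ < 1 ∧ z = (r / 2 : ℂ) * (w + w⁻¹) := by
  have hr : (r : ℂ) ≠ 0 := by exact_mod_cast hr0.ne'
  -- The candidates `z/r ± d` are mutually inverse, so one lies in the open disc unless both have
  -- modulus one. In that case `z = r Re w` would lie in `[-r, r]`.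
  obtain ⟨d, hd⟩ := IsAlgClosed.exists_pow_nat_eq ((z / r) ^ 2 - 1) (n := 2) (by norm_num)
  have hprod : (z / r + d) * (z / r - d) = 1 := by linear_combination -hd
  set w := z / r + d with hw
  have hw0 : w ≠ 0 := left_ne_zero_of_mul_eq_one hprod
  have hinv : w⁻¹ = z / r - d := inv_eq_of_mul_eq_one_right hprod
  have hzw : z = (r / 2 : ℂ) * (w + w⁻¹) := by
    rw [hinv, hw]
    field_simp
    ring
  rcases lt_trichotomy ‖w‖ 1 with h | h | h
  · exact ⟨w, hw0, h, hzw⟩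
  · exfalso
    apply hz
    have hre : |w.re| ≤ 1 := h ▸ Complex.abs_re_le_norm w
    obtain ⟨ha, hb⟩ := abs_le.1 hre
    refine ⟨r * w.re, ⟨by nlinarith, by nlinarith⟩, ?_⟩
    have hconj : w⁻¹ = (starRingEnd ℂ) w := Complex.inv_eq_conj h
    rw [hzw, hconj, Complex.add_conj]
    push_cast
    ring
  · refine ⟨w⁻¹, inv_ne_zero hw0, ?_, by rw [hzw, inv_inv, add_comm w]⟩
    rw [norm_inv]
    exact inv_lt_one_of_one_lt₀ h

theorem abs_eval_jacobiPoly_konno_le (hr0 : 0 < r) (hr1 : r < 1) (n : ℕ) {x : ℝ}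
    (hx : x ∈ Set.Icc (-r) r) :
    |(jacobiPoly (konnoBeta r) (konnoGamma r) (n + 1)).eval x| ≤ 4 * (r / 2) ^ (n + 1) := by
  have ha : -1 ≤ x / r := by rw [le_div_iff₀ hr0]; linarith [hx.1]
  have hb : x / r ≤ 1 := by rw [div_le_iff₀ hr0]; linarith [hx.2]
  have e : x = r * Real.cos (Real.arccos (x / r)) := by
    rw [Real.cos_arccos ha hb]
    field_simp
  obtain ⟨ht0, ht1⟩ := konnoRadius_mem_Ioo hr0 hr1
  rw [e, eval_jacobiPoly_konno hr0 hr1, abs_mul, abs_of_pos (by positivity)]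
  set θ := Real.arccos (x / r)
  have h1 := Real.abs_cos_le_one ((n + 1 : ℕ) * θ)
  have h2 : |konnoRadius r * Real.cos (n * θ)| ≤ 1 := by
    rw [abs_mul, abs_of_pos ht0]
    nlinarith [Real.abs_cos_le_one (n * θ), abs_nonneg (Real.cos (n * θ))]
  have h3 := abs_sub (Real.cos ((n + 1 : ℕ) * θ)) (konnoRadius r * Real.cos (n * θ))
  have : 0 < (r / 2) ^ (n + 1) := by positivity
  nlinarith

theorem tendsto_convs_jacobiFraction_konno (hr0 : 0 < r) (hr1 : r < 1) {z : ℂ}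
    (hz : z ∉ (fun x : ℝ => (x : ℂ)) '' Set.Icc (-r) r) :
    Tendsto (fun n : ℕ => (jacobiFraction (konnoBeta r) (konnoGamma r) z).convs.get n) atTop
      (𝓝 (stieltjesTransform (konnoMeasure r 1) z)) := by
  have := isProbabilityMeasure_konnoMeasure hr0 hr1
  obtain ⟨w, hw0, hw1, hzw⟩ := exists_joukowski hr0 hz
  obtain ⟨ht0, ht1⟩ := konnoRadius_mem_Ioo hr0 hr1
  have hne : ∀ x ∈ Set.Icc (-r) r, z - (x : ℂ) ≠ 0 := fun x hx h =>
    hz ⟨x, hx, (sub_eq_zero.1 h).symm⟩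
  have hcont : ContinuousOn (fun x : ℝ => (z - (x : ℂ))⁻¹) (Set.Icc (-r) r) :=
    ContinuousOn.inv₀ (by fun_prop) hne
  obtain ⟨C, hC⟩ := isCompact_Icc.exists_bound_of_continuousOn hcont
  have hrem := aeval_mul_stieltjesTransform_sub_nums (isJacobiParameters_konno hr0 hr1) (z := z)
    ((ae_mem_Icc_konnoMeasure r).mono fun x hx => sub_ne_zero.1 (hne x hx))
    (fun p => integrable_konnoMeasure hr0 hr1
      (by simp only [div_eq_mul_inv]; exact ContinuousOn.mul (by fun_prop) hcont))
  set P := fun n => Polynomial.aeval z (jacobiPoly (konnoBeta r) (konnoGamma r) n) with hP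
  set G := stieltjesTransform (konnoMeasure r 1) z
  set Q := (jacobiFraction (konnoBeta r) (konnoGamma r) z).nums with hQ
  have hbound : ∀ n, ‖P (n + 1) * G - Q (n + 1)‖ ≤ 4 * (r / 2) ^ (n + 1) * C := by
    intro n
    rw [hrem]
    refine (norm_integral_le_of_norm_le_const (C := 4 * (r / 2) ^ (n + 1) * C) ?_).trans (by simp)
    filter_upwards [ae_mem_Icc_konnoMeasure r] with x hx
    rw [div_eq_mul_inv, norm_mul, Complex.norm_real, Real.norm_eq_abs]
    exact mul_le_mul (abs_eval_jacobiPoly_konno_le hr0 hr1 n hx) (hC x hx) (norm_nonneg _)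
      (by positivity)
  have hpow : ∀ a : ℕ, Tendsto (fun n : ℕ => w ^ (2 * n + a)) atTop (𝓝 0) := fun a =>
    (tendsto_pow_atTop_nhds_zero_of_norm_lt_one hw1).comp
      (tendsto_atTop_mono (fun n => by omega : ∀ n : ℕ, n ≤ 2 * n + a) tendsto_id)
  have hden : Tendsto (fun n : ℕ => (w * (2 / r)) ^ (n + 1) * P (n + 1)) atTop
      (𝓝 (1 - konnoRadius r * w)) := by
    have e : ∀ n : ℕ, (w * (2 / r)) ^ (n + 1) * P (n + 1) =
        1 - konnoRadius r * w + (w ^ (2 * n + 2) - konnoRadius r * w ^ (2 * n + 1)) := fun n => by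
      simp only [hP]
      rw [← aeval_jacobiPoly_konno hr0 hr1 n hw0, ← hzw]
    simp_rw [e]
    simpa using tendsto_const_nhds.add ((hpow 2).sub ((hpow 1).const_mul (konnoRadius r : ℂ)))
  -- Holds since `t < 1` and `|w| < 1`; it also makes the denominators eventually nonzero.
  have hlim : 1 - (konnoRadius r : ℂ) * w ≠ 0 := by
    intro h
    have h1 : ‖(konnoRadius r : ℂ) * w‖ = 1 := by rw [← sub_eq_zero.1 h, norm_one]
    rw [norm_mul, Complex.norm_real, Real.norm_eq_abs, abs_of_pos ht0] at h1
    nlinarith [norm_nonneg w]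
  have hnum : Tendsto (fun n : ℕ => (w * (2 / r)) ^ (n + 1) * (P (n + 1) * G - Q (n + 1))) atTop
      (𝓝 0) := by
    have h0 : Tendsto (fun n : ℕ => ‖w‖ ^ (n + 1) * (4 * C)) atTop (𝓝 0) := by
      simpa using ((tendsto_add_atTop_iff_nat 1).2
        (tendsto_pow_atTop_nhds_zero_of_lt_one (norm_nonneg w) hw1)).mul_const (4 * C)
    refine squeeze_zero_norm (fun n => ?_) h0
    have hn : ‖(w * (2 / r)) ^ (n + 1)‖ * (r / 2) ^ (n + 1) = ‖w‖ ^ (n + 1) := by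
      rw [norm_pow, ← mul_pow, norm_mul, norm_div, Complex.norm_real, Real.norm_eq_abs,
        abs_of_pos hr0, Complex.norm_two]
      congr 1
      field_simp
    calc _ ≤ ‖(w * (2 / r)) ^ (n + 1)‖ * (4 * (r / 2) ^ (n + 1) * C) := by
          rw [norm_mul]
          gcongr
          exact hbound n
      _ = _ := by rw [← hn]; ring
  rw [← tendsto_add_atTop_iff_nat 1]
  -- Once `Pₙ ≠ 0`, the convergent is `Qₙ / Pₙ = G - (Pₙ G - Qₙ) / Pₙ`.
  have hquot := (tendsto_const_nhds (x := G)).sub (hnum.div hden hlim)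
  rw [zero_div, sub_zero] at hquot
  refine hquot.congr' ?_
  filter_upwards [hden.eventually_ne hlim] with n hn
  have hconv : (jacobiFraction (konnoBeta r) (konnoGamma r) z).convs.get (n + 1) =
      Q (n + 1) / P (n + 1) := by
    simp only [hP, ← jacobiFraction_dens]
    rfl
  have hn1 := left_ne_zero_of_mul hn
  have hn2 := right_ne_zero_of_mul hn
  rw [hconv, Pi.div_apply, mul_div_mul_left _ _ hn1]
  field_simp
  ring

end

theorem proposition4p2 (r : ℝ) (hr0 : 0 < r) (hr1 : r < 1) :
    IsProbabilityMeasure (konnoMeasure r 1) ∧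
    ∀ β γ : ℕ → ℝ,
      (IsJacobiParameters (konnoMeasure r 1) β γ ↔
        (β 0 = 1 - √(1 - r ^ 2) ∧
          β 1 = -(1 - √(1 - r ^ 2)) / 2 ∧
          (∀ n : ℕ, 2 ≤ n → β n = 0) ∧
          γ 0 = √(1 - r ^ 2) * (1 - √(1 - r ^ 2)) ∧
          ∀ n : ℕ, 1 ≤ n → γ n = r ^ 2 / 4)) ∧
      (IsJacobiParameters (konnoMeasure r 1) β γ →
        ∀ z : ℂ, z ∉ (fun x : ℝ => (x : ℂ)) '' Set.Icc (-r) r →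
          Tendsto (fun n : ℕ => (jacobiFraction β γ z).convs.get n) atTop
            (𝓝 (stieltjesTransform (konnoMeasure r 1) z))) := by
  have hJ := isJacobiParameters_konno hr0 hr1
  refine ⟨isProbabilityMeasure_konnoMeasure hr0 hr1, fun β γ => ⟨⟨fun h => ?_, ?_⟩, fun h z hz => ?_⟩⟩
  · obtain ⟨rfl, rfl⟩ := h.unique hJ
    refine ⟨rfl, rfl, fun n hn => ?_, rfl, fun n hn => ?_⟩
    · obtain ⟨k, rfl⟩ := Nat.exists_eq_add_of_le' hn
      rfl
    · obtain ⟨k, rfl⟩ := Nat.exists_eq_add_of_le' hn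
      rfl
  · rintro ⟨h0, h1, h2, h3, h4⟩
    have hβ : β = konnoBeta r := by
      funext n
      match n with
      | 0 => exact h0
      | 1 => exact h1
      | k + 2 => exact h2 (k + 2) (by omega)
    have hγ : γ = konnoGamma r := by
      funext n
      match n with
      | 0 => exact h3
      | k + 1 => exact h4 (k + 1) (by omega)
    rw [hβ, hγ]
    exact hJ
  · obtain ⟨rfl, rfl⟩ := h.unique hJ
    exact tendsto_convs_jacobiFraction_konno hr0 hr1 hz
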